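/- Corollary 4.5. Let $n\ge 0$ be an integer, let $T:\mathbb{R}^n\to\mathbb{R}^n$ be a Borel automorphism (a bijection such that $T$ and $T^{-1}$ are Borel measurable), and let $\Sigma_0,\Sigma_1,\dots,\Sigma_n$ be real positive definite $n\times n$ matrices such that, for $1\le j\le n$, $\operatorname{rank}(\Sigma_j-\Sigma_0)=1$ and $\operatorname{Range}(\Sigma_j-\Sigma_0)=\mathbb{R}u_j$, where $u_1,\dots,u_n$ are unit vectors forming a basis of $\mathbb{R}^n$. Let $D_n$ be the set of the $2^n$ diagonal $n\times n$ matrices with diagonal entries $\pm1$, let $L$ be Lebesgue measure on $\mathbb{R}^n$, and call a family $\{E_s\}_{s\in D_n}$ of Borel sets a Lebesgue partition if $L(\mathbb{R}^n\setminus\bigcup_s E_s)=0$ and $L(E_s\cap E_t)=0$ for all $s\ne t$. For positive definite $\Sigma$ let $N(0,\Sigma)$ be the centered Gaussian law on $\mathbb{R}^n$ with covariance matrix $\Sigma$, let $N(0,\Sigma)T^{-1}$ be its image under $T$, and let $\Sigma^{1/2}$ be the positive definite square root of $\Sigma$. Let $\Psi_0$ be a positive definite $n\times n$ matrix. Then there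 exist positive definite matrices $\Psi_1,\dots,\Psi_n$ with $$N(0,\Sigma_j)T^{-1}=N(0,\Psi_j)\qquad (0\le j\le n)$$ if and only if there exist orthogonal $n\times n$ matrices $U,V$ and a Lebesgue partition $\{E_s\}_{s\in D_n}$ such that (a) $\{VsU(E_s)\}_{s\in D_n}$ is also a Lebesgue partition; (b) for Lebesgue-almost every $x$, $$T(x)=\sum_{s\in D_n}1_{E_s}\big(\Sigma_0^{-1/2}x\big)\,\Psi_0^{1/2}\,V s U\,\Sigma_0^{-1/2}x ;$$ (c) for every $1\le j\le n$, the matrix $(VsU)\,\Sigma_0^{-1/2}\Sigma_j\Sigma_0^{-1/2}\,(VsU)^{-1}$ is the same for all $s\in D_n$ with $L(E_s)>0$. -/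

import Mathlib

open MeasureTheory ProbabilityTheory
open scoped MatrixOrder

namespace NormalityPreserving

/-- The element `diag (s₁, …, sₙ)` of `D_n`, the set of diagonal matrices with entries `±1`;
`s ↦ signDiag s` is a bijection from the sign vectors `Fin n → ℤˣ` onto `D_n`. -/
def signDiag {n : ℕ} (s : Fin n → ℤˣ) : Matrix (Fin n) (Fin n) ℝ :=
  Matrix.diagonal fun i => ((s i : ℤ) : ℝ)

/-- A Lebesgue partition of `ℝⁿ` over `D_n`: Borel sets, indexed by `D_n`, which cover `ℝⁿ` up to
a Lebesgue null set and whose pairwise intersections are Lebesgue null. -/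
structure IsLebesguePartition {n : ℕ}
    (E : (Fin n → ℤˣ) → Set (EuclideanSpace ℝ (Fin n))) : Prop where
  measurableSet : ∀ s, MeasurableSet (E s)
  compl_iUnion_null : volume (⋃ s, E s)ᶜ = 0
  inter_null : ∀ s t, s ≠ t → volume (E s ∩ E t) = 0

/-- The linear map `x ↦ A x` of `ℝⁿ` given by a matrix `A`. -/
noncomputable abbrev act {n : ℕ} (A : Matrix (Fin n) (Fin n) ℝ) :
    EuclideanSpace ℝ (Fin n) →L[ℝ] EuclideanSpace ℝ (Fin n) :=
  Matrix.toEuclideanCLM (n := Fin n) (𝕜 := ℝ) A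

/-- The normal law `N(0, S)` on `ℝⁿ`, used for positive definite `S` only. -/
noncomputable abbrev normalLaw {n : ℕ} (S : Matrix (Fin n) (Fin n) ℝ) :
    Measure (EuclideanSpace ℝ (Fin n)) :=
  multivariateGaussian 0 S

/-- The positive definite square root `S^{1/2}`, used for positive definite `S` only. -/
noncomputable abbrev sqrtMat {n : ℕ} (S : Matrix (Fin n) (Fin n) ℝ) :
    Matrix (Fin n) (Fin n) ℝ :=
  CFC.sqrt S

end NormalityPreserving

/-! Let `R` and `P` be the square roots of `Σ₀` and `Ψ₀`. Replacing `T` by `P⁻¹ T R` reduces the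
forward direction to an automorphism `T` that preserves the standard normal law and sends each `N(0,
1 + c v vᵀ)`, with one unit vector `v` per basis vector, to some `N(0, Ψ)`.

Densities relative to a law that `T` preserves are transported by composition with `T`. Taking
logarithms, a quadratic form at `T x` equals a multiple of `⟨v, x⟩²` plus a constant.
Semidefiniteness kills the constant, and integrating the identity against both laws gives the traces
of `Ψ` and `Ψ⁻¹`, which force `Ψ = 1 + c w wᵀ`. Hence `⟨w, T x⟩² = ⟨v, x⟩²` almost everywhere
(`exists_inner_sq_comp_ae_eq`).

With the `v`'s and `w`'s as rows of `B` and `W`, this says `W T(x) = s B x` for a sign matrix `s`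
depending on `x`, so `T` is piecewise `W⁻¹ s B`. A centered normal law is determined by its
restriction to a set of positive measure, so on each nonnull piece the linear map itself must
transport covariances (`covariance_eq_of_eqOn`). This makes `W⁻¹ s B` orthogonal there, and a polar
decomposition writes it as `V s U` with `U`, `V` independent of `s`
(`exists_orthogonal_mul_signDiag_mul`). The same principle applied to the other laws yields (c).

Conversely, each piece carries the restricted source law to the restriction of one common normal law
to the image piece. The images tile the space, so the restrictions add up
(`map_normalLaw_of_partition`). -/

namespace NormalityPreserving

/-! ### Linear images and the standard Gaussian density -/

open Matrix Complex in
theorem normalLaw_map {n : ℕ} {S : Matrix (Fin n) (Fin n) ℝ} (hS : S.PosSemidef)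
    (A : Matrix (Fin n) (Fin n) ℝ) :
    (normalLaw S).map (act A) = normalLaw (A * S * Aᵀ) := by
  have hS' : (A * S * Aᵀ).PosSemidef := by
    simpa using hS.mul_mul_conjTranspose_same A
  apply Measure.ext_of_charFun
  ext t
  have h := charFun_multivariateGaussian (μ := 0) hS (act Aᵀ t)
  rw [charFun_multivariateGaussian hS']
  rw [charFun_apply, integral_map (by fun_prop) (by fun_prop)]
  have hin : ∀ x, inner ℝ (act A x) t = inner ℝ x (act Aᵀ t) := by
    intro x
    rw [real_inner_comm, inner_toEuclideanCLM, inner_toEuclideanCLM]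
    simp [dotProduct_mulVec, vecMul_transpose, dotProduct_comm]
  simp_rw [hin]
  rw [← charFun_apply, h]
  simp [ofLp_toEuclideanCLM, dotProduct_mulVec, ← mulVec_transpose, mulVec_mulVec, mul_assoc]

-- Both sides have the same characteristic function, by the Fourier transform of a Gaussian. The
-- constant stays implicit because later arguments only need its positivity.
open Complex in
theorem stdGaussian_eq_withDensity {n : ℕ} : ∃ c : ℝ, 0 < c ∧
    stdGaussian (EuclideanSpace ℝ (Fin n)) =
      volume.withDensity fun x => ENNReal.ofReal (c * Real.exp (-(1 / 2) * ‖x‖ ^ 2)) := by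
  set I : ℝ := (Real.pi / (1 / 2 : ℝ)) ^ (Module.finrank ℝ (EuclideanSpace ℝ (Fin n)) / 2 : ℝ)
  have hI : 0 < I := by positivity
  have h1 : ∫ x : EuclideanSpace ℝ (Fin n), Real.exp (-(1 / 2) * ‖x‖ ^ 2) = I :=
    GaussianFourier.integral_rexp_neg_mul_sq_norm (by norm_num)
  -- A non-integrable function would have integral `0` by convention, but the integral is positive.
  have hint : Integrable fun x : EuclideanSpace ℝ (Fin n) => Real.exp (-(1 / 2) * ‖x‖ ^ 2) := by
    by_contra h
    rw [integral_undef h] at h1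
    exact hI.ne h1
  have hintc : Integrable fun x : EuclideanSpace ℝ (Fin n) =>
    I⁻¹ * Real.exp (-(1 / 2) * ‖x‖ ^ 2) := hint.const_mul _
  refine ⟨I⁻¹, by positivity, ?_⟩
  have : IsFiniteMeasure (volume.withDensity fun x : EuclideanSpace ℝ (Fin n) =>
      ENNReal.ofReal (I⁻¹ * Real.exp (-(1 / 2) * ‖x‖ ^ 2))) :=
    isFiniteMeasure_withDensity_ofReal hintc.2
  apply Measure.ext_of_charFun
  ext t
  rw [charFun_stdGaussian, charFun_apply]
  rw [integral_withDensity_eq_integral_toReal_smul (by fun_prop) (by simp)]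
  have h2 := GaussianFourier.integral_cexp_neg_mul_sq_norm_add (V := EuclideanSpace ℝ (Fin n))
    (b := 1 / 2) (by norm_num) Complex.I t
  have h3 : ((Real.pi / (1 / 2) : ℂ)) ^ (Module.finrank ℝ (EuclideanSpace ℝ (Fin n)) / 2 : ℂ)
      = (I : ℂ) := by
    rw [ofReal_cpow (by positivity)]; push_cast; rfl
  rw [h3] at h2
  trans (I : ℂ)⁻¹ * ((I : ℂ) * cexp (Complex.I ^ 2 * ‖t‖ ^ 2 / (4 * (1 / 2))))
  · have : (I : ℂ) ≠ 0 := by exact_mod_cast hI.ne'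
    field_simp
    simp
    ring_nf
  · rw [← h2, ← integral_const_mul]
    congr 1
    ext x
    rw [ENNReal.toReal_ofReal (by positivity), real_smul, Complex.exp_add, real_inner_comm]
    push_cast
    ring_nf

/-! ### Quadratic forms -/

/-- The quadratic form `x ↦ xᵀ Q x`. -/
noncomputable def quadForm {n : ℕ} (Q : Matrix (Fin n) (Fin n) ℝ)
    (x : EuclideanSpace ℝ (Fin n)) : ℝ :=
  inner ℝ x (act Q x)

section quadForm

variable {n : ℕ} (Q R A : Matrix (Fin n) (Fin n) ℝ) (x y : EuclideanSpace ℝ (Fin n)) (c : ℝ)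

theorem continuous_quadForm : Continuous (quadForm Q) := by
  unfold quadForm; fun_prop

@[fun_prop]
theorem measurable_quadForm : Measurable (quadForm Q) := (continuous_quadForm Q).measurable

theorem quadForm_sub : quadForm (Q - R) x = quadForm Q x - quadForm R x := by
  simp [quadForm, inner_sub_right]

theorem quadForm_smul : quadForm (c • Q) x = c * quadForm Q x := by
  simp [quadForm, inner_smul_right]

theorem quadForm_neg : quadForm (-Q) x = -quadForm Q x := by
  simp [quadForm]

theorem quadForm_one : quadForm 1 x = ‖x‖ ^ 2 := by
  simp [quadForm]

theorem quadForm_apply_smul : quadForm Q (c • x) = c ^ 2 * quadForm Q x := by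
  simp [quadForm, inner_smul_left, inner_smul_right]; ring

@[simp]
theorem quadForm_zero_right : quadForm Q 0 = 0 := by simp [quadForm]

theorem act_mul_apply : act (A * Q) x = act A (act Q x) := by
  simp [act]

theorem act_one_apply : act 1 x = x := by simp [act]

theorem inner_act_left : inner ℝ (act A x) y = inner ℝ x (act A.transpose y) := by
  rw [real_inner_comm, Matrix.inner_toEuclideanCLM, Matrix.inner_toEuclideanCLM]
  simp [Matrix.dotProduct_mulVec, Matrix.vecMul_transpose, dotProduct_comm]

theorem quadForm_act : quadForm Q (act A x) = quadForm (A.transpose * Q * A) x := by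
  simp only [quadForm, inner_act_left, ← act_mul_apply, mul_assoc]

theorem quadForm_eq_sum : quadForm Q x = ∑ i, ∑ j, Q i j * (x i * x j) := by
  rw [quadForm, Matrix.inner_toEuclideanCLM]
  simp only [dotProduct, Matrix.mulVec, Finset.mul_sum]
  refine Finset.sum_congr rfl fun i _ => Finset.sum_congr rfl fun j _ => by ring

theorem quadForm_vecMulVec (v : EuclideanSpace ℝ (Fin n)) :
    quadForm (Matrix.vecMulVec v v) x = inner ℝ v x ^ 2 := by
  rw [quadForm_eq_sum]
  simp only [PiLp.inner_apply, RCLike.inner_apply, conj_trivial, sq, Finset.sum_mul_sum,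
    Matrix.vecMulVec_apply]
  refine Finset.sum_congr rfl fun i _ => Finset.sum_congr rfl fun j _ => by ring

variable {Q}

theorem quadForm_add_smul (hQ : Q.transpose = Q) :
    quadForm Q (x + c • y) =
      quadForm Q y * c ^ 2 + 2 * inner ℝ x (act Q y) * c + quadForm Q x := by
  have h : inner ℝ y (act Q x) = inner ℝ x (act Q y) := by
    rw [real_inner_comm, inner_act_left, hQ]
  simp only [quadForm, map_add, map_smul, inner_add_left, inner_add_right, inner_smul_left,
    inner_smul_right, h, conj_trivial]
  ring

theorem eq_zero_of_quadForm_eq_zero (hQ : Q.transpose = Q) (h : ∀ x, quadForm Q x = 0) :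
    Q = 0 := by
  have hxy : ∀ x y, inner ℝ x (act Q y) = 0 := by
    intro x y
    have := quadForm_add_smul x y 1 hQ
    simp only [h] at this
    linarith
  have : act Q = 0 := by
    ext1 y
    exact ext_inner_left ℝ fun x => by simp [hxy]
  exact (map_eq_zero_iff _ (Matrix.toEuclideanCLM (n := Fin n) (𝕜 := ℝ)).injective).1 this

end quadForm

/-- A quadratic polynomial without linear term vanishing on a set of positive measure is zero. -/
theorem quadForm_eq_zero_of_volume_ne_zero {n : ℕ} {Q : Matrix (Fin n) (Fin n) ℝ}
    (hQ : Q.transpose = Q) {c : ℝ}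
    (h : volume {x : EuclideanSpace ℝ (Fin n) | quadForm Q x + c = 0} ≠ 0) : Q = 0 ∧ c = 0 := by
  have hQ0 : Q = 0 := by
    by_contra hne
    obtain ⟨v, hv⟩ : ∃ v, quadForm Q v ≠ 0 := by
      by_contra! hall
      exact hne (eq_zero_of_quadForm_eq_zero hQ hall)
    apply h
    have hm : MeasurableSet {x : EuclideanSpace ℝ (Fin n) | quadForm Q x + c = 0} :=
      (measurable_quadForm Q).add_const c (measurableSet_singleton 0)
    -- Fubini along lines in direction `v`: since `quadForm Q v ≠ 0`, each restriction is a
    -- polynomial of exact degree two and has finitely many zeros.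
    have := ae_mem_of_ae_add_linearMap_mem (LinearMap.toSpanSingleton ℝ _ v) volume volume
      hm.compl (fun x => ?_)
    · rw [ae_iff] at this
      simpa using this
    · simp only [LinearMap.toSpanSingleton_apply, Set.mem_compl_iff, Set.mem_ofPred_eq]
      rw [ae_iff]
      simp only [not_not]
      refine Set.Finite.measure_zero ?_ _
      have hp : (Polynomial.C (quadForm Q v) * Polynomial.X ^ 2 +
          Polynomial.C (2 * inner ℝ x (act Q v)) * Polynomial.X +
          Polynomial.C (quadForm Q x + c)) ≠ 0 := fun h0 => by
        exact hv (by simpa using congrArg (fun p => Polynomial.coeff p 2) h0)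
      refine (Polynomial.finite_setOfPred_isRoot hp).subset fun t ht => ?_
      have ht' : quadForm Q (x + t • v) + c = 0 := ht
      rw [quadForm_add_smul x v t hQ] at ht'
      simp [Polynomial.IsRoot]
      linarith
  subst hQ0
  refine ⟨rfl, ?_⟩
  by_contra hc
  exact h (by simp [quadForm, hc])

/-! ### Densities and second moments of normal laws -/

theorem map_withDensity_measurableEquiv {α β : Type*} [MeasurableSpace α] [MeasurableSpace β]
    (μ : Measure α) (f : α → ENNReal) (e : α ≃ᵐ β) :
    (μ.withDensity f).map e = (μ.map e).withDensity (f ∘ e.symm) := by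
  ext s hs
  rw [e.map_apply, withDensity_apply _ (e.measurable hs), withDensity_apply _ hs,
    e.restrict_map, lintegral_map_equiv]
  simp

/-- The linear automorphism of `ℝⁿ` given by an invertible matrix. -/
noncomputable def actEquiv {n : ℕ} (A : Matrix (Fin n) (Fin n) ℝ) (hA : IsUnit A.det) :
    EuclideanSpace ℝ (Fin n) ≃ᵐ EuclideanSpace ℝ (Fin n) where
  toFun := act A
  invFun := act A⁻¹
  left_inv x := by rw [← act_mul_apply, Matrix.nonsing_inv_mul _ hA, act_one_apply]
  right_inv x := by rw [← act_mul_apply, Matrix.mul_nonsing_inv _ hA, act_one_apply]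
  measurable_toFun := (act A).continuous.measurable
  measurable_invFun := (act A⁻¹).continuous.measurable

theorem act_injective {n : ℕ} {A : Matrix (Fin n) (Fin n) ℝ} (hA : IsUnit A.det) :
    Function.Injective (act A) :=
  (actEquiv A hA).injective

theorem volume_map_act {n : ℕ} (A : Matrix (Fin n) (Fin n) ℝ) (hA : IsUnit A.det) :
    ∃ c : ℝ, 0 < c ∧ (volume : Measure (EuclideanSpace ℝ (Fin n))).map (act A) =
      ENNReal.ofReal c • volume := by
  have hdet : LinearMap.det (act A).toLinearMap ≠ 0 := by
    have : LinearMap.det (act A).toLinearMap = A.det := by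
      rw [Matrix.coe_toEuclideanCLM_eq_toEuclideanLin]
      rw [show Matrix.toEuclideanLin A = Matrix.toLin (PiLp.basisFun 2 ℝ (Fin n))
        (PiLp.basisFun 2 ℝ (Fin n)) A from DFunLike.congr_fun (Matrix.toLpLin_eq_toLin 2 2) A,
        LinearMap.det_toLin]
    rw [this]; exact hA.ne_zero
  exact ⟨_, by positivity, Measure.map_linearMap_addHaar_eq_smul_addHaar volume hdet⟩

theorem normalLaw_eq_withDensity {n : ℕ} {S : Matrix (Fin n) (Fin n) ℝ} (hS : S.PosDef) :
    ∃ c : ℝ, 0 < c ∧ normalLaw S =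
      volume.withDensity fun x => ENNReal.ofReal (c * Real.exp (-(1 / 2) * quadForm S⁻¹ x)) := by
  set A := CFC.sqrt S with hAdef
  have hAA : A * A = S := CFC.sqrt_mul_sqrt_self _ hS.posSemidef.nonneg
  have hAt : A.transpose = A := by
    simpa using (Matrix.nonneg_iff_posSemidef.1 (CFC.sqrt_nonneg S)).isHermitian.eq
  have hA : IsUnit A.det := by
    have : IsUnit (A * A).det := by rw [hAA]; exact (Matrix.isUnit_iff_isUnit_det _).1 hS.isUnit
    rw [Matrix.det_mul] at this
    exact isUnit_of_mul_isUnit_left this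
  obtain ⟨c, hc, hstd⟩ := stdGaussian_eq_withDensity (n := n)
  obtain ⟨d, hd, hvol⟩ := volume_map_act A hA
  refine ⟨d * c, by positivity, ?_⟩
  have h1 : normalLaw S = (stdGaussian (EuclideanSpace ℝ (Fin n))).map (actEquiv A hA) := by
    simp [normalLaw, multivariateGaussian, actEquiv, A]
  have hvol' : (volume : Measure (EuclideanSpace ℝ (Fin n))).map (actEquiv A hA) =
    ENNReal.ofReal d • volume := hvol
  rw [h1, hstd, map_withDensity_measurableEquiv, hvol', withDensity_smul_measure,
    ← withDensity_smul _ (by fun_prop)]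
  congr 1
  ext x
  have hx : ‖act A⁻¹ x‖ ^ 2 = quadForm S⁻¹ x := by
    rw [← quadForm_one, quadForm_act, Matrix.transpose_nonsing_inv, hAt, mul_one,
      ← Matrix.mul_inv_rev, hAA]
  have hx' : (actEquiv A hA).symm x = act A⁻¹ x := rfl
  simp only [Pi.smul_apply, Function.comp, smul_eq_mul, hx', hx]
  rw [← ENNReal.ofReal_mul hd.le, mul_assoc]

theorem normalLaw_absolutelyContinuous {n : ℕ} {S : Matrix (Fin n) (Fin n) ℝ} (hS : S.PosDef) :
    normalLaw S ≪ volume := by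
  obtain ⟨c, -, h⟩ := normalLaw_eq_withDensity hS
  rw [h]; exact withDensity_absolutelyContinuous _ _

theorem absolutelyContinuous_normalLaw {n : ℕ} {S : Matrix (Fin n) (Fin n) ℝ} (hS : S.PosDef) :
    volume ≪ normalLaw S := by
  obtain ⟨c, hc, h⟩ := normalLaw_eq_withDensity hS
  rw [h]
  refine withDensity_absolutelyContinuous' (by fun_prop) ?_
  filter_upwards with x
  positivity

/-- The standard law serves as reference measure because the normalized `T` preserves it, so no
Jacobian of `T` ever enters. -/
theorem normalLaw_eq_withDensity_std {n : ℕ} {S : Matrix (Fin n) (Fin n) ℝ} (hS : S.PosDef) :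
    ∃ k : ℝ, normalLaw S = (normalLaw 1).withDensity fun x =>
      ENNReal.ofReal (Real.exp (k + quadForm ((1 / 2 : ℝ) • (1 - S⁻¹)) x)) := by
  obtain ⟨c, hc, h⟩ := normalLaw_eq_withDensity hS
  obtain ⟨d, hd, h'⟩ := normalLaw_eq_withDensity (n := n) Matrix.PosDef.one
  refine ⟨Real.log c - Real.log d, ?_⟩
  rw [h, h', ← withDensity_mul _ (by fun_prop) (by fun_prop)]
  congr 1
  ext x
  rw [Pi.mul_apply, ← ENNReal.ofReal_mul (by positivity), quadForm_smul, quadForm_sub]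
  congr 1
  rw [Real.exp_add, Real.exp_sub, Real.exp_log hc, Real.exp_log hd, inv_one]
  rw [show -(1 / 2) * quadForm S⁻¹ x = -(1 / 2) * quadForm 1 x +
    1 / 2 * (quadForm 1 x - quadForm S⁻¹ x) by ring, Real.exp_add]
  field_simp

theorem integrable_mul_coord {n : ℕ} (S : Matrix (Fin n) (Fin n) ℝ) (i j : Fin n) :
    Integrable (fun x => x i * x j) (normalLaw S) := by
  have h : ∀ i, MemLp (fun x : EuclideanSpace ℝ (Fin n) => x i) 2 (normalLaw S) := fun i => by
    simpa using (EuclideanSpace.proj (𝕜 := ℝ) i).comp_memLp'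
      (IsGaussian.memLp_two_id (μ := normalLaw S))
  exact (h i).integrable_mul (h j)

theorem integral_quadForm {n : ℕ} {S : Matrix (Fin n) (Fin n) ℝ} (hS : S.PosSemidef)
    (Q : Matrix (Fin n) (Fin n) ℝ) :
    ∫ x, quadForm Q x ∂normalLaw S = (Q * S).trace := by
  have hcov : ∀ i j, ∫ x, x i * x j ∂normalLaw S = S j i := by
    intro i j
    have h := covariance_eval_multivariateGaussian (μ := 0) hS i j
    have h0 : ∀ i, ∫ x, x i ∂normalLaw S = 0 := fun i => by
      have := (EuclideanSpace.proj (𝕜 := ℝ) i).integral_comp_comm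
        (IsGaussian.integrable_id (μ := normalLaw S))
      simpa using this
    rw [covariance, h0, h0] at h
    simp only [sub_zero] at h
    rw [h]
    simpa using congrFun (congrFun hS.isHermitian.eq j) i
  calc ∫ x, quadForm Q x ∂normalLaw S
      = ∑ i, ∑ j, ∫ x, Q i j * (x i * x j) ∂normalLaw S := by
        simp_rw [quadForm_eq_sum]
        rw [integral_finsetSum Finset.univ fun i _ => integrable_finsetSum _ fun j _ =>
          (integrable_mul_coord S i j).const_mul (Q i j)]
        exact Finset.sum_congr rfl fun i _ => integral_finsetSum Finset.univ fun j _ =>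
          (integrable_mul_coord S i j).const_mul (Q i j)
    _ = (Q * S).trace := by
        simp_rw [integral_const_mul, hcov]
        simp [Matrix.trace, Matrix.mul_apply]

theorem ae_volume_iff_ae_std {n : ℕ} {p : EuclideanSpace ℝ (Fin n) → Prop} :
    (∀ᵐ x, p x) ↔ ∀ᵐ x ∂normalLaw 1, p x :=
  ⟨fun h => (normalLaw_absolutelyContinuous Matrix.PosDef.one).ae_le h,
    fun h => (absolutelyContinuous_normalLaw Matrix.PosDef.one).ae_le h⟩

/-! ### Quadratic forms composed with Gaussian-preserving maps -/

theorem le_of_ae_le_of_continuous {n : ℕ} {f : EuclideanSpace ℝ (Fin n) → ℝ} (hf : Continuous f)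
    {k : ℝ} (h : ∀ᵐ x, k ≤ f x) (x : EuclideanSpace ℝ (Fin n)) : k ≤ f x := by
  have hd := Measure.dense_of_ae h
  have hc : IsClosed {x | k ≤ f x} := isClosed_le continuous_const hf
  have : x ∈ closure {x | k ≤ f x} := hd x
  rwa [hc.closure_eq] at this

/-- By homogeneity, a negative value scales to `-∞`. -/
theorem quadForm_nonneg_of_le {n : ℕ} {A : Matrix (Fin n) (Fin n) ℝ} {k : ℝ}
    (h : ∀ y, k ≤ quadForm A y) (y : EuclideanSpace ℝ (Fin n)) : 0 ≤ quadForm A y := by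
  by_contra! hq
  set q := quadForm A y
  -- Squaring this factor makes the form at most `q - 2|k|`, which is below `k`.
  have h1 := h ((1 + |k| / -q) • y)
  rw [quadForm_apply_smul] at h1
  change k ≤ (1 + |k| / -q) ^ 2 * q at h1
  have h2 : 0 ≤ |k| / -q := div_nonneg (abs_nonneg k) (by linarith)
  have h3 : |k| / -q * -q = |k| := div_mul_cancel₀ _ (by linarith)
  have h4 := neg_abs_le k
  generalize |k| / -q = r at *
  nlinarith [mul_nonneg (mul_nonneg h2 h2) (neg_nonneg.2 hq.le), abs_nonneg k]

/-- If a quadratic form composed with a standard Gaussian preserving map is a nonnegative quadratic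
form plus a constant, then it is nonnegative and the constant vanishes. -/
theorem const_eq_zero_of_quadForm_comp {n : ℕ} {A B : Matrix (Fin n) (Fin n) ℝ} {k : ℝ}
    {T : EuclideanSpace ℝ (Fin n) ≃ᵐ EuclideanSpace ℝ (Fin n)}
    (hT : (normalLaw 1).map T = normalLaw 1) (hB : ∀ x, 0 ≤ quadForm B x)
    (h : ∀ᵐ x ∂normalLaw 1, quadForm A (T x) = quadForm B x + k) :
    k = 0 ∧ ∀ y, 0 ≤ quadForm A y := by
  have h1 : ∀ᵐ y ∂normalLaw 1, k ≤ quadForm A y := by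
    rw [← hT, ae_map_iff T.measurable.aemeasurable
      (measurableSet_le measurable_const (measurable_quadForm A))]
    filter_upwards [h] with x hx
    rw [hx]; linarith [hB x]
  have hA := quadForm_nonneg_of_le
    (le_of_ae_le_of_continuous (continuous_quadForm A) (ae_volume_iff_ae_std.2 h1))
  have h2 : ∀ᵐ x, 0 ≤ quadForm B x + k := by
    rw [ae_volume_iff_ae_std]
    filter_upwards [h] with x hx
    rw [← hx]; exact hA _
  have h3 := le_of_ae_le_of_continuous ((continuous_quadForm B).add_const k) h2 0
  have h4 := le_of_ae_le_of_continuous (continuous_quadForm A) (ae_volume_iff_ae_std.2 h1) 0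
  simp only [quadForm_zero_right] at h3 h4
  exact ⟨by linarith, hA⟩

/-! ### Spectral rigidity from two traces -/

theorem exists_orthogonal_diagonalization {n : ℕ} {Ψ : Matrix (Fin n) (Fin n) ℝ}
    (hΨ : Ψ.PosDef) : ∃ (O : Matrix (Fin n) (Fin n) ℝ) (d : Fin n → ℝ), O.transpose * O = 1 ∧
      (∀ i, 0 < d i) ∧ Ψ = O * Matrix.diagonal d * O.transpose := by
  have hH := hΨ.isHermitian
  refine ⟨hH.eigenvectorUnitary, hH.eigenvalues, ?_, hΨ.eigenvalues_pos, ?_⟩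
  · exact (Matrix.mem_unitaryGroup_iff'.1 hH.eigenvectorUnitary.2)
  · conv_lhs => rw [hH.spectral_theorem, Unitary.conjStarAlgAut_apply]
    rfl

/-- Positive reals lying on one side of `1` whose sum and sum of inverses agree with those of
`1 + c, 1, …, 1` are a permutation of these numbers. -/
theorem exists_eq_one_add_pi_single {n : ℕ} {d : Fin n → ℝ} {c : ℝ} (hc : c ≠ 0) (hc1 : 0 < 1 + c)
    (hd : ∀ i, 0 < d i) (h1 : ∑ i, d i = n + c) (h2 : ∑ i, (d i)⁻¹ = n - c / (1 + c))
    (h3 : ∀ i, 0 ≤ c * (1 - (d i)⁻¹)) : ∃ i, d = fun j => 1 + (Pi.single i c : Fin n → ℝ) j := by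
  have hs1 : ∑ i, (d i - 1) = c := by simp [Finset.sum_sub_distrib, h1]
  have hs2 : ∑ i, (1 - (d i)⁻¹) = c / (1 + c) := by simp [Finset.sum_sub_distrib, h2]
  have hsgn : ∀ i, 0 ≤ c * (d i - 1) := fun i => by
    have := mul_nonneg (h3 i) (hd i).le
    have e : c * (1 - (d i)⁻¹) * d i = c * (d i - 1) := by
      have := (hd i).ne'
      field_simp
    rwa [e] at this
  have hle : ∀ i, c * (d i - 1) ≤ c * c := fun i => by
    have := Finset.single_le_sum (fun i _ => hsgn i) (Finset.mem_univ i)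
    rwa [← Finset.mul_sum, hs1] at this
  -- All `d i - 1` lie between `0` and `c`, so these terms are nonnegative. The two sum conditions
  -- make their total vanish, so each `d i - 1` is `0` or `c`.
  have hterm : ∀ i, 0 ≤ (d i - 1) * (c - (d i - 1)) / d i := fun i => by
    refine div_nonneg ?_ (hd i).le
    have h := mul_nonneg (hsgn i) (sub_nonneg.2 (hle i))
    have e : c * (d i - 1) * (c * c - c * (d i - 1)) =
      c ^ 2 * ((d i - 1) * (c - (d i - 1))) := by ring
    rw [e] at h
    exact nonneg_of_mul_nonneg_right h (by positivity)
  have hsum : ∑ i, (d i - 1) * (c - (d i - 1)) / d i = 0 := by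
    have e : ∀ i, (d i - 1) * (c - (d i - 1)) / d i =
        (1 + c) * (1 - (d i)⁻¹) - (d i - 1) := fun i => by
      have := (hd i).ne'
      field_simp; ring
    simp_rw [e]
    rw [Finset.sum_sub_distrib, ← Finset.mul_sum, hs1, hs2]
    field_simp; ring
  have hz : ∀ i, d i - 1 = 0 ∨ d i - 1 = c := fun i => by
    have := (Finset.sum_eq_zero_iff_of_nonneg fun i _ => hterm i).1 hsum i (Finset.mem_univ i)
    rcases div_eq_zero_iff.1 this with h | h
    · rcases mul_eq_zero.1 h with h | h
      · exact Or.inl h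
      · right; linarith
    · exact absurd h (hd i).ne'
  obtain ⟨i, hi⟩ : ∃ i, d i - 1 = c := by
    by_contra! hne
    apply hc
    rw [← hs1]
    exact Finset.sum_eq_zero fun i _ => (hz i).resolve_right (hne i)
  refine ⟨i, funext fun j => ?_⟩
  by_cases hj : j = i
  · subst hj; rw [Pi.single_eq_same]; linarith
  · rw [Pi.single_eq_of_ne hj]
    rcases hz j with h | h
    · linarith
    · exfalso
      have h5 : ∑ k ∈ {i, j}, c * (d k - 1) ≤ ∑ k, c * (d k - 1) :=
        Finset.sum_le_sum_of_subset_of_nonneg (Finset.subset_univ _) fun k _ _ => hsgn k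
      rw [Finset.sum_pair (Ne.symm hj), ← Finset.mul_sum, hs1, hi, h] at h5
      have : 0 < c * c := mul_self_pos.2 hc
      linarith

theorem exists_eq_one_add_vecMulVec {n : ℕ} {Ψ : Matrix (Fin n) (Fin n) ℝ} (hΨ : Ψ.PosDef)
    {c : ℝ} (hc : c ≠ 0) (hc1 : 0 < 1 + c) (h1 : Ψ.trace = n + c)
    (h2 : Ψ⁻¹.trace = n - c / (1 + c)) (h3 : ∀ y, 0 ≤ c * quadForm (1 - Ψ⁻¹) y) :
    ∃ w : EuclideanSpace ℝ (Fin n), ‖w‖ = 1 ∧ Ψ = 1 + c • Matrix.vecMulVec w w := by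
  obtain ⟨O, d, hO, hd, hdiag⟩ := exists_orthogonal_diagonalization hΨ
  have hO' : O * O.transpose = 1 := mul_eq_one_comm.1 hO
  have hinv : Ψ⁻¹ = O * Matrix.diagonal (fun i => (d i)⁻¹) * O.transpose := by
    apply Matrix.inv_eq_right_inv
    calc Ψ * (O * Matrix.diagonal (fun i => (d i)⁻¹) * O.transpose)
        = O * Matrix.diagonal d * (O.transpose * O) * Matrix.diagonal (fun i => (d i)⁻¹) *
          O.transpose := by rw [hdiag]; simp only [mul_assoc]
      _ = O * O.transpose := by
        rw [hO, mul_one, mul_assoc O, Matrix.diagonal_mul_diagonal]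
        simp [mul_inv_cancel₀ (hd _).ne']
      _ = 1 := hO'
  have htr : ∀ D : Matrix (Fin n) (Fin n) ℝ, (O * D * O.transpose).trace = D.trace := fun D => by
    rw [Matrix.trace_mul_cycle, hO, one_mul]
  obtain ⟨i, hi⟩ := exists_eq_one_add_pi_single hc hc1 hd
    (by rw [← h1, hdiag, htr, Matrix.trace_diagonal])
    (by rw [← h2, hinv, htr, Matrix.trace_diagonal]) (fun i => by
      -- Testing on the `i`-th eigenvector gives the sign condition on the `i`-th eigenvalue.
      have h := h3 (act O (EuclideanSpace.single i 1))
      have e : O.transpose * (1 - Ψ⁻¹) * O = Matrix.diagonal (fun i => 1 - (d i)⁻¹) := by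
        rw [mul_sub, sub_mul, mul_one, hO, hinv]
        have : O.transpose * (O * Matrix.diagonal (fun i => (d i)⁻¹) * O.transpose) * O =
          (O.transpose * O) * Matrix.diagonal (fun i => (d i)⁻¹) * (O.transpose * O) := by
            simp only [mul_assoc]
        rw [this, hO, one_mul, mul_one, ← Matrix.diagonal_one, Matrix.diagonal_sub]
      rw [quadForm_act, e] at h
      simpa [quadForm_eq_sum, Matrix.diagonal_apply] using h)
  refine ⟨WithLp.toLp 2 fun j => O j i, ?_, ?_⟩
  · have h := congrFun (congrFun hO i) i
    rw [Matrix.mul_apply] at h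
    simp only [Matrix.transpose_apply, Matrix.one_apply_eq] at h
    rw [EuclideanSpace.norm_eq]
    simp [sq, h]
  · have e : Matrix.diagonal d = 1 + c • Matrix.single i i (1 : ℝ) := by
      rw [hi, ← Matrix.diagonal_one, ← Matrix.diagonal_single, ← Matrix.diagonal_smul,
        Matrix.diagonal_add]
      congr 1; ext j
      simp [Pi.single_apply]
    rw [hdiag, e, mul_add, add_mul, mul_one, hO', mul_smul_comm, smul_mul_assoc]
    congr 2
    ext j k
    simp [Matrix.mul_apply, Matrix.vecMulVec_apply, Matrix.single_apply, ite_and]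

/-! ### Comparison of log-densities and the rank-one identity -/

theorem exists_quadForm_comp_ae_eq {n : ℕ} {S Ψ : Matrix (Fin n) (Fin n) ℝ}
    (hS : S.PosDef) (hΨ : Ψ.PosDef) {T : EuclideanSpace ℝ (Fin n) ≃ᵐ EuclideanSpace ℝ (Fin n)}
    (hT : (normalLaw 1).map T = normalLaw 1) (hTS : (normalLaw S).map T = normalLaw Ψ) :
    ∃ k, ∀ᵐ x ∂normalLaw 1, quadForm ((1 / 2 : ℝ) • (1 - Ψ⁻¹)) (T x) =
      quadForm ((1 / 2 : ℝ) • (1 - S⁻¹)) x + k := by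
  obtain ⟨k, hk⟩ := normalLaw_eq_withDensity_std hS
  obtain ⟨l, hl⟩ := normalLaw_eq_withDensity_std hΨ
  refine ⟨k - l, ?_⟩
  rw [hk, hl, map_withDensity_measurableEquiv, hT,
    withDensity_eq_iff_of_sigmaFinite (by fun_prop) (by fun_prop)] at hTS
  have h : ∀ᵐ x ∂(normalLaw 1).map T, ((fun x => ENNReal.ofReal (Real.exp (k +
      quadForm ((1 / 2 : ℝ) • (1 - S⁻¹)) x))) ∘ T.symm) x = ENNReal.ofReal (Real.exp (l +
      quadForm ((1 / 2 : ℝ) • (1 - Ψ⁻¹)) x)) := by rw [hT]; exact hTS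
  filter_upwards [ae_of_ae_map T.measurable.aemeasurable h] with x hx
  simp only [Function.comp, T.symm_apply_apply] at hx
  rw [ENNReal.ofReal_eq_ofReal_iff (by positivity) (by positivity)] at hx
  linarith [Real.exp_injective hx]

/-- Integrate the identity against `N(0, S)`: the mean of a quadratic form under a centered normal
law is a trace. -/
theorem trace_eq_of_quadForm_comp {n : ℕ} {S Ψ A B : Matrix (Fin n) (Fin n) ℝ}
    (hS : S.PosDef) (hΨ : Ψ.PosDef) {T : EuclideanSpace ℝ (Fin n) ≃ᵐ EuclideanSpace ℝ (Fin n)}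
    (hTS : (normalLaw S).map T = normalLaw Ψ) (h : ∀ᵐ x, quadForm A (T x) = quadForm B x) :
    (A * Ψ).trace = (B * S).trace := by
  rw [← integral_quadForm hΨ.posSemidef, ← integral_quadForm hS.posSemidef, ← hTS,
    integral_map T.measurable.aemeasurable (measurable_quadForm A).aestronglyMeasurable]
  exact integral_congr_ae ((normalLaw_absolutelyContinuous hS).ae_le h)

section RankOne

variable {n : ℕ} {v : EuclideanSpace ℝ (Fin n)} {c : ℝ}

theorem trace_vecMulVec_self (hv : ‖v‖ = 1) : (Matrix.vecMulVec v v).trace = 1 := by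
  rw [Matrix.trace_vecMulVec, ← one_pow 2, ← hv, EuclideanSpace.real_norm_sq_eq]
  simp [dotProduct, sq]

theorem vecMulVec_self_mul_self (hv : ‖v‖ = 1) :
    Matrix.vecMulVec v v * Matrix.vecMulVec v v = Matrix.vecMulVec v v := by
  have h := trace_vecMulVec_self hv
  rw [Matrix.trace_vecMulVec] at h
  rw [Matrix.vecMulVec_mul_vecMulVec, h, one_smul]

theorem inv_one_add_smul_vecMulVec (hv : ‖v‖ = 1) (hc : 1 + c ≠ 0) :
    (1 + c • Matrix.vecMulVec v v)⁻¹ = 1 - (c / (1 + c)) • Matrix.vecMulVec v v := by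
  apply Matrix.inv_eq_right_inv
  rw [mul_sub, mul_one, mul_smul_comm, add_mul, one_mul, smul_mul_assoc,
    vecMulVec_self_mul_self hv]
  match_scalars <;> field_simp
  ring

theorem one_add_pos_of_posDef (hv : ‖v‖ = 1) (h : (1 + c • Matrix.vecMulVec v v).PosDef) :
    0 < 1 + c := by
  have hv0 : WithLp.ofLp v ≠ 0 := fun h0 => by
    have : v = 0 := WithLp.ofLp_injective 2 h0
    simp [this] at hv
  have h1 := h.dotProduct_mulVec_pos hv0
  have h2 := trace_vecMulVec_self hv
  rw [Matrix.trace_vecMulVec] at h2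
  simpa [Matrix.add_mulVec, Matrix.smul_mulVec, Matrix.vecMulVec_mulVec, h2] using h1

end RankOne

/-- The log-density identity involves an unknown `Ψ`. Its constant term vanishes, and the traces of
`Ψ` and `Ψ⁻¹` then agree with those of the source, which leaves only `Ψ = 1 + c w wᵀ` with `w` a
unit vector. -/
theorem exists_inner_sq_comp_ae_eq {n : ℕ} {v : EuclideanSpace ℝ (Fin n)} {c : ℝ}
    (hv : ‖v‖ = 1) (hc : c ≠ 0) {Ψ : Matrix (Fin n) (Fin n) ℝ}
    (hS : (1 + c • Matrix.vecMulVec v v).PosDef) (hΨ : Ψ.PosDef)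
    {T : EuclideanSpace ℝ (Fin n) ≃ᵐ EuclideanSpace ℝ (Fin n)}
    (hT : (normalLaw 1).map T = normalLaw 1)
    (hTS : (normalLaw (1 + c • Matrix.vecMulVec v v)).map T = normalLaw Ψ) :
    ∃ w : EuclideanSpace ℝ (Fin n), ∀ᵐ x, inner ℝ w (T x) ^ 2 = inner ℝ v x ^ 2 := by
  have hc1 := one_add_pos_of_posDef hv hS
  have hform : ∀ w : EuclideanSpace ℝ (Fin n), ‖w‖ = 1 → ∀ x,
      quadForm ((1 / 2 : ℝ) • (1 - (1 + c • Matrix.vecMulVec w w)⁻¹)) x =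
        c * (1 / (2 * (1 + c)) * inner ℝ w x ^ 2) := fun w hw x => by
    rw [inv_one_add_smul_vecMulVec hw hc1.ne', sub_sub_cancel, quadForm_smul, quadForm_smul,
      quadForm_vecMulVec]
    field_simp
  obtain ⟨k, hk⟩ := exists_quadForm_comp_ae_eq hS hΨ hT hTS
  set S := 1 + c • Matrix.vecMulVec v v with hSdef
  set A := (1 / 2 : ℝ) • (1 - Ψ⁻¹) with hA
  set B := (1 / 2 : ℝ) • (1 - S⁻¹) with hB
  have hkey : k = 0 ∧ ∀ y, 0 ≤ c * quadForm A y := by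
    rcases lt_or_gt_of_ne hc with hneg | hpos
    -- For `c < 0` the source form is nonpositive, so all signs are flipped.
    · obtain ⟨h1, h2⟩ := const_eq_zero_of_quadForm_comp (A := -A) (B := -B) (k := -k) hT
        (fun x => by
          rw [quadForm_neg, hform v hv]
          have : 0 ≤ -c * (1 / (2 * (1 + c)) * inner ℝ v x ^ 2) :=
            mul_nonneg (by linarith) (by positivity)
          linarith)
        (by filter_upwards [hk] with x hx; rw [quadForm_neg, quadForm_neg, hx]; ring)
      refine ⟨by linarith, fun y => ?_⟩
      have := h2 y
      rw [quadForm_neg] at this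
      exact mul_nonneg_of_nonpos_of_nonpos hneg.le (by linarith)
    · obtain ⟨h1, h2⟩ := const_eq_zero_of_quadForm_comp hT
        (fun x => by rw [hform v hv]; positivity) hk
      exact ⟨h1, fun y => mul_nonneg hpos.le (h2 y)⟩
  obtain ⟨rfl, hsgn⟩ := hkey
  simp only [add_zero] at hk
  rw [← ae_volume_iff_ae_std] at hk
  -- Integration against the standard law fixes the trace of `Ψ⁻¹`; integration against `N(0, S)`
  -- fixes that of `Ψ`.
  have ht1 := trace_eq_of_quadForm_comp Matrix.PosDef.one Matrix.PosDef.one hT hk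
  have ht2 := trace_eq_of_quadForm_comp hS hΨ hTS hk
  have hmul : ∀ M : Matrix (Fin n) (Fin n) ℝ, M.PosDef →
      (((1 / 2 : ℝ) • (1 - M⁻¹)) * M).trace = 1 / 2 * (M.trace - n) := fun M hM => by
    rw [smul_mul_assoc, sub_mul, Matrix.nonsing_inv_mul _
      ((Matrix.isUnit_iff_isUnit_det _).1 hM.isUnit), one_mul, Matrix.trace_smul,
      Matrix.trace_sub, Matrix.trace_one, Fintype.card_fin, smul_eq_mul]
  rw [hmul Ψ hΨ, hmul S hS] at ht2
  simp only [hA, hB, mul_one, Matrix.trace_smul, Matrix.trace_sub, Matrix.trace_one,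
    Fintype.card_fin, smul_eq_mul] at ht1
  have hSt : S.trace = n + c := by
    simp [hSdef, Matrix.trace_add, Matrix.trace_smul, trace_vecMulVec_self hv]
  have hSit : S⁻¹.trace = n - c / (1 + c) := by
    rw [hSdef, inv_one_add_smul_vecMulVec hv hc1.ne']
    simp [Matrix.trace_sub, Matrix.trace_smul, trace_vecMulVec_self hv]
  obtain ⟨w, hw, hΨw⟩ := exists_eq_one_add_vecMulVec hΨ hc hc1 (by linarith) (by linarith)
    (fun y => by
      have := hsgn y
      rw [hA, quadForm_smul] at this
      linarith)
  refine ⟨w, ?_⟩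
  filter_upwards [hk] with x hx
  rw [hA, hB, hΨw, hform w hw, hSdef, hform v hv] at hx
  have h0 : (1 / (2 * (1 + c))) ≠ 0 := by positivity
  exact mul_left_cancel₀ h0 (mul_left_cancel₀ hc hx)

/-! ### Rigidity of normal laws on sets of positive measure -/

theorem posDef_mul_mul_transpose {n : ℕ} {S A : Matrix (Fin n) (Fin n) ℝ} (hS : S.PosDef)
    (hA : IsUnit A.det) : (A * S * A.transpose).PosDef := by
  have := hS.mul_mul_conjTranspose_same (B := A)
    (Matrix.vecMul_injective_of_isUnit ((Matrix.isUnit_iff_isUnit_det _).2 hA))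
  rwa [Matrix.conjTranspose_eq_transpose_of_trivial] at this

/-- Equality of the log-densities on `F` is the vanishing of a quadratic polynomial without linear
term, which cannot happen on a nonnull set unless the polynomial is zero. -/
theorem eq_of_restrict_normalLaw_eq {n : ℕ} {Φ Ψ : Matrix (Fin n) (Fin n) ℝ}
    (hΦ : Φ.PosDef) (hΨ : Ψ.PosDef) {F : Set (EuclideanSpace ℝ (Fin n))} (hF : MeasurableSet F)
    (hF0 : volume F ≠ 0) (h : (normalLaw Φ).restrict F = (normalLaw Ψ).restrict F) : Φ = Ψ := by
  obtain ⟨k, hk, hk'⟩ := normalLaw_eq_withDensity hΦ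
  obtain ⟨l, hl, hl'⟩ := normalLaw_eq_withDensity hΨ
  rw [hk', hl', restrict_withDensity hF, restrict_withDensity hF,
    withDensity_eq_iff_of_sigmaFinite (by fun_prop) (by fun_prop), Filter.EventuallyEq,
    ae_restrict_iff' hF] at h
  have hsub : ∀ᵐ x, x ∈ F → quadForm (Ψ⁻¹ - Φ⁻¹) x + 2 * (Real.log k - Real.log l) = 0 := by
    filter_upwards [h] with x hx hxF
    have := hx hxF
    rw [ENNReal.ofReal_eq_ofReal_iff (by positivity) (by positivity)] at this
    have := congrArg Real.log this
    rw [Real.log_mul hk.ne' (by positivity), Real.log_mul hl.ne' (by positivity), Real.log_exp,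
      Real.log_exp] at this
    rw [quadForm_sub]
    linarith
  have hsymm : (Ψ⁻¹ - Φ⁻¹).transpose = Ψ⁻¹ - Φ⁻¹ := by
    have h1 := hΨ.inv.isHermitian.eq
    have h2 := hΦ.inv.isHermitian.eq
    rw [Matrix.conjTranspose_eq_transpose_of_trivial] at h1 h2
    rw [Matrix.transpose_sub, h1, h2]
  have h0 := (quadForm_eq_zero_of_volume_ne_zero hsymm (c := 2 * (Real.log k - Real.log l))
    fun h0 => hF0 (measure_mono_null_ae hsub h0)).1
  have := sub_eq_zero.1 h0
  rw [← Matrix.nonsing_inv_nonsing_inv Φ ((Matrix.isUnit_iff_isUnit_det _).1 hΦ.isUnit), ← this,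
    Matrix.nonsing_inv_nonsing_inv Ψ ((Matrix.isUnit_iff_isUnit_det _).1 hΨ.isUnit)]

/-- If a map sends a normal law to a normal law and is linear on a set of positive measure, then
the linear map relates the covariance matrices. -/
theorem covariance_eq_of_eqOn {n : ℕ} {S Ψ A : Matrix (Fin n) (Fin n) ℝ}
    (hS : S.PosDef) (hΨ : Ψ.PosDef) (hA : IsUnit A.det)
    {T : EuclideanSpace ℝ (Fin n) ≃ᵐ EuclideanSpace ℝ (Fin n)}
    (hTS : (normalLaw S).map T = normalLaw Ψ) {E : Set (EuclideanSpace ℝ (Fin n))}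
    (hE : MeasurableSet E) (hE0 : volume E ≠ 0) (hTA : Set.EqOn T (act A) E) :
    A * S * A.transpose = Ψ := by
  have himg : T '' E = actEquiv A hA '' E := hTA.image_eq
  have hpd := posDef_mul_mul_transpose hS hA
  have hAm : (normalLaw S).map (actEquiv A hA) = normalLaw (A * S * A.transpose) :=
    normalLaw_map hS.posSemidef A
  have hrestr : ∀ e : EuclideanSpace ℝ (Fin n) ≃ᵐ EuclideanSpace ℝ (Fin n),
      ((normalLaw S).map e).restrict (e '' E) = ((normalLaw S).restrict E).map e := fun e => by
    rw [e.restrict_map, e.injective.preimage_image]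
  refine eq_of_restrict_normalLaw_eq hpd hΨ (F := T '' E) ((T.measurableSet_image).2 hE) ?_ ?_
  · rw [himg]
    intro h0
    have h1 : (normalLaw (A * S * A.transpose)) (actEquiv A hA '' E) = 0 :=
      normalLaw_absolutelyContinuous hpd h0
    rw [← hAm, (actEquiv A hA).map_apply, (actEquiv A hA).injective.preimage_image] at h1
    exact hE0 (absolutelyContinuous_normalLaw hS h1)
  · rw [← hAm, ← hTS, hrestr, himg, hrestr]
    refine Measure.map_congr ?_
    rw [Filter.EventuallyEq, ae_restrict_iff' hE]
    exact Filter.Eventually.of_forall fun x hx => (hTA hx).symm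

/-! ### Square roots, sign matrices and polar decomposition -/

section sqrtMat

variable {n : ℕ} {S : Matrix (Fin n) (Fin n) ℝ}

theorem sqrtMat_mul_self (hS : S.PosDef) : sqrtMat S * sqrtMat S = S :=
  CFC.sqrt_mul_sqrt_self _ hS.posSemidef.nonneg

theorem transpose_sqrtMat : (sqrtMat S).transpose = sqrtMat S := by
  simpa using (Matrix.nonneg_iff_posSemidef.1 (CFC.sqrt_nonneg S)).isHermitian.eq

theorem isUnit_det_of_posDef (hS : S.PosDef) : IsUnit S.det :=
  (Matrix.isUnit_iff_isUnit_det _).1 hS.isUnit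

theorem isUnit_det_sqrtMat (hS : S.PosDef) : IsUnit (sqrtMat S).det := by
  have := isUnit_det_of_posDef hS
  rw [← sqrtMat_mul_self hS, Matrix.det_mul] at this
  exact isUnit_of_mul_isUnit_left this

end sqrtMat

section signDiag

variable {n : ℕ} (s : Fin n → ℤˣ)

theorem signDiag_mul_self : signDiag s * signDiag s = 1 := by
  rw [signDiag, Matrix.diagonal_mul_diagonal, ← Matrix.diagonal_one]
  congr 1; ext i
  rcases Int.units_eq_one_or (s i) with h | h <;> simp [h]

theorem transpose_signDiag : (signDiag s).transpose = signDiag s :=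
  Matrix.diagonal_transpose _

theorem act_signDiag_apply (x : EuclideanSpace ℝ (Fin n)) (i : Fin n) :
    act (signDiag s) x i = ((s i : ℤ) : ℝ) * x i := by
  simp [Matrix.ofLp_toEuclideanCLM, signDiag, Matrix.mulVec_diagonal]

theorem isUnit_det_signDiag : IsUnit (signDiag s).det :=
  Matrix.isUnit_det_of_right_inverse (signDiag_mul_self s)

end signDiag

/-- Two-sided polar decomposition: the orthogonal ones among the matrices `W⁻¹ s B`, with `s` a
sign matrix, are of the form `V s U` for orthogonal matrices `U`, `V` independent of `s`. -/
theorem exists_orthogonal_mul_signDiag_mul {n : ℕ} {W B : Matrix (Fin n) (Fin n) ℝ}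
    (hW : IsUnit W.det) (hB : IsUnit B.det) :
    ∃ U ∈ Matrix.orthogonalGroup (Fin n) ℝ, ∃ V ∈ Matrix.orthogonalGroup (Fin n) ℝ,
      ∀ s, (W⁻¹ * signDiag s * B) * (W⁻¹ * signDiag s * B).transpose = 1 →
        V * signDiag s * U = W⁻¹ * signDiag s * B := by
  have hpd : ∀ M : Matrix (Fin n) (Fin n) ℝ, IsUnit M.det → (M * M.transpose)⁻¹.PosDef := by
    intro M hM
    have := Matrix.PosDef.mul_conjTranspose_self M
      (Matrix.vecMul_injective_of_isUnit ((Matrix.isUnit_iff_isUnit_det _).2 hM))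
    rw [Matrix.conjTranspose_eq_transpose_of_trivial] at this
    exact this.inv
  have hK := hpd B hB
  have hG := hpd W hW
  set K := (B * B.transpose)⁻¹ with hKdef
  set G := (W * W.transpose)⁻¹ with hGdef
  set H := sqrtMat K
  set J := sqrtMat G
  have hHH : H * H = K := sqrtMat_mul_self hK
  have hJJ : J * J = G := sqrtMat_mul_self hG
  have hJ : IsUnit J.det := isUnit_det_sqrtMat hG
  have hHt : H.transpose = H := transpose_sqrtMat
  have hJt : J.transpose = J := transpose_sqrtMat
  have hBt : IsUnit B.transpose.det := by rwa [Matrix.det_transpose]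
  have hWt : IsUnit W.transpose.det := by rwa [Matrix.det_transpose]
  -- These are the orthogonal polar factors of `B` and `W⁻¹`. Orthogonality of `W⁻¹ s B` means `s B
  -- Bᵀ s = W Wᵀ`; by uniqueness of square roots `J = s H s`, so `J⁻¹ s H = s`.
  refine ⟨H * B, ?_, W⁻¹ * J⁻¹, ?_, fun s hs => ?_⟩
  · rw [Matrix.mem_orthogonalGroup_iff', Matrix.transpose_mul, hHt, mul_assoc,
      ← mul_assoc H, hHH, hKdef, Matrix.mul_inv_rev, mul_assoc, Matrix.nonsing_inv_mul _ hB,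
      mul_one, Matrix.mul_nonsing_inv _ hBt]
  · rw [Matrix.mem_orthogonalGroup_iff, Matrix.transpose_mul,
      Matrix.transpose_nonsing_inv, Matrix.transpose_nonsing_inv, hJt, mul_assoc,
      ← mul_assoc J⁻¹, ← Matrix.mul_inv_rev, hJJ, hGdef,
      Matrix.nonsing_inv_nonsing_inv _ (by rw [Matrix.det_mul]; exact hW.mul hWt), mul_assoc W,
      Matrix.mul_nonsing_inv _ hWt, mul_one, Matrix.nonsing_inv_mul _ hW]
  · set D := signDiag s
    have hDD : D * D = 1 := signDiag_mul_self s
    have hDt : D.transpose = D := transpose_signDiag s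
    have hWW : D * (B * B.transpose) * D = W * W.transpose := by
      calc D * (B * B.transpose) * D
          = W * ((W⁻¹ * D * B) * (W⁻¹ * D * B).transpose) * W.transpose := by
            simp only [Matrix.transpose_mul, Matrix.transpose_nonsing_inv, hDt]
            simp only [mul_assoc, Matrix.nonsing_inv_mul _ hWt, mul_one,
              Matrix.mul_nonsing_inv_cancel_left _ _ hW]
        _ = W * W.transpose := by rw [hs, mul_one]
    have hDinv : D⁻¹ = D := Matrix.inv_eq_right_inv hDD
    have hGK : D * K * D = G := by
      rw [hGdef, ← hWW, Matrix.mul_inv_rev, Matrix.mul_inv_rev, hDinv, mul_assoc]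
    have hJH : J = D * H * D := by
      refine CFC.sqrt_unique ?_ ?_
      · calc D * H * D * (D * H * D) = D * H * (D * D) * H * D := by simp only [mul_assoc]
          _ = D * (H * H) * D := by rw [hDD, mul_one, mul_assoc D]
          _ = G := by rw [hHH, hGK]
      · rw [Matrix.nonneg_iff_posSemidef]
        have := (Matrix.nonneg_iff_posSemidef.1 (CFC.sqrt_nonneg K)).mul_mul_conjTranspose_same D
        rwa [Matrix.conjTranspose_eq_transpose_of_trivial, hDt] at this
    have hJD : D * H = J * D := by rw [hJH, mul_assoc, hDD, mul_one]
    calc W⁻¹ * J⁻¹ * D * (H * B) = W⁻¹ * (J⁻¹ * (D * H)) * B := by simp only [mul_assoc]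
      _ = W⁻¹ * D * B := by
        rw [hJD, Matrix.nonsing_inv_mul_cancel_left _ _ hJ]

/-! ### Recovering the signs -/

theorem ae_inner_ne_zero {n : ℕ} {a : EuclideanSpace ℝ (Fin n)} (ha : a ≠ 0) :
    ∀ᵐ x, inner ℝ a x ≠ 0 := by
  rw [ae_iff]
  by_contra h
  have h1 : {x : EuclideanSpace ℝ (Fin n) | ¬inner ℝ a x ≠ 0} =
      {x | quadForm (Matrix.vecMulVec a a) x + 0 = 0} := by
    ext x; simp [quadForm_vecMulVec]
  rw [h1] at h
  have h2 := (quadForm_eq_zero_of_volume_ne_zero (Matrix.transpose_vecMulVec _ _) h).1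
  have h3 := quadForm_vecMulVec a a
  rw [h2] at h3
  apply ha
  simpa [quadForm] using h3.symm

theorem exists_sign_of_sq_eq {n : ℕ} {a b : Fin n → ℝ} (h : ∀ j, a j ^ 2 = b j ^ 2) :
    ∃ s : Fin n → ℤˣ, ∀ j, a j = ((s j : ℤ) : ℝ) * b j := by
  have : ∀ j, ∃ s : ℤˣ, a j = ((s : ℤ) : ℝ) * b j := fun j => by
    rcases sq_eq_sq_iff_eq_or_eq_neg.1 (h j) with h | h
    · exact ⟨1, by simp [h]⟩
    · exact ⟨-1, by simp [h]⟩
  choose s hs using this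
  exact ⟨s, hs⟩

theorem exists_act_eq_act_signDiag_mul {n : ℕ} {W B : Matrix (Fin n) (Fin n) ℝ}
    {x y : EuclideanSpace ℝ (Fin n)} (h : ∀ j, act W y j ^ 2 = act B x j ^ 2) :
    ∃ s, act W y = act (signDiag s * B) x := by
  obtain ⟨s, hs⟩ := exists_sign_of_sq_eq h
  refine ⟨s, ?_⟩
  ext j
  rw [hs, act_mul_apply, act_signDiag_apply]

/-- If `zᵀ W = 0` with `z ≠ 0`, then almost every `x` satisfies `zᵀ s B x = 0` for one of finitely
many `s`; these are proper hyperplanes because `s B` is invertible. -/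
theorem isUnit_det_of_sq_comp_ae_eq {n : ℕ} {W B : Matrix (Fin n) (Fin n) ℝ} (hB : IsUnit B.det)
    {T : EuclideanSpace ℝ (Fin n) → EuclideanSpace ℝ (Fin n)}
    (h : ∀ᵐ x, ∀ j, act W (T x) j ^ 2 = act B x j ^ 2) : IsUnit W.det := by
  by_contra hW
  rw [isUnit_iff_ne_zero, not_not, ← Matrix.exists_vecMul_eq_zero_iff] at hW
  obtain ⟨z, hz, hzW⟩ := hW
  have hnz : ∀ s, act (signDiag s * B).transpose (WithLp.toLp 2 z) ≠ 0 := fun s h0 => by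
    have hu : IsUnit (signDiag s * B).transpose.det := by
      rw [Matrix.det_transpose, Matrix.det_mul]
      exact (isUnit_det_signDiag s).mul hB
    have := act_injective hu (h0.trans (map_zero (act (signDiag s * B).transpose)).symm)
    exact hz (congrArg WithLp.ofLp this)
  have hae : ∀ᵐ x, ∀ s, inner ℝ (act (signDiag s * B).transpose (WithLp.toLp 2 z)) x ≠ 0 :=
    ae_all_iff.2 fun s => ae_inner_ne_zero (hnz s)
  obtain ⟨x, hx, hx'⟩ := (h.and hae).exists
  obtain ⟨s, hs⟩ := exists_act_eq_act_signDiag_mul hx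
  apply hx' s
  rw [inner_act_left, Matrix.transpose_transpose, ← hs, Matrix.inner_toEuclideanCLM,
    Matrix.dotProduct_mulVec]
  simp [hzW]

section orthogonal

variable {n : ℕ} {U V : Matrix (Fin n) (Fin n) ℝ}

theorem mul_signDiag_mul_mem_orthogonalGroup (hU : U ∈ Matrix.orthogonalGroup (Fin n) ℝ)
    (hV : V ∈ Matrix.orthogonalGroup (Fin n) ℝ) (s : Fin n → ℤˣ) :
    V * signDiag s * U ∈ Matrix.orthogonalGroup (Fin n) ℝ := by
  refine mul_mem (mul_mem hV ?_) hU
  rw [Matrix.mem_orthogonalGroup_iff, transpose_signDiag, signDiag_mul_self]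

theorem isUnit_det_of_mem_orthogonalGroup (hU : U ∈ Matrix.orthogonalGroup (Fin n) ℝ) :
    IsUnit U.det :=
  Matrix.isUnit_det_of_right_inverse ((Matrix.mem_orthogonalGroup_iff _ _).1 hU)

theorem inv_eq_transpose_of_mem_orthogonalGroup (hU : U ∈ Matrix.orthogonalGroup (Fin n) ℝ) :
    U⁻¹ = U.transpose :=
  Matrix.inv_eq_right_inv ((Matrix.mem_orthogonalGroup_iff _ _).1 hU)

theorem apply_eq_zero_of_act_signDiag_eq {s t : Fin n → ℤˣ} {i : Fin n} (hi : s i ≠ t i)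
    {y : EuclideanSpace ℝ (Fin n)} (h : act (signDiag s) y = act (signDiag t) y) : y i = 0 := by
  have h1 : act (signDiag s) y i = act (signDiag t) y i := by rw [h]
  rw [act_signDiag_apply, act_signDiag_apply] at h1
  by_contra hy
  have h2 : ((s i : ℤ) : ℝ) = ((t i : ℤ) : ℝ) := mul_right_cancel₀ hy h1
  exact hi (Units.ext (Int.cast_injective h2))

theorem ae_act_mul_signDiag_mul_ne (hU : IsUnit U.det) (hV : IsUnit V.det)
    {s t : Fin n → ℤˣ} (hst : s ≠ t) :
    ∀ᵐ x, act (V * signDiag s * U) x ≠ act (V * signDiag t * U) x := by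
  obtain ⟨i, hi⟩ := Function.ne_iff.1 hst
  have hUt : IsUnit U.transpose.det := by rwa [Matrix.det_transpose]
  have hne : act U.transpose (EuclideanSpace.single i 1) ≠ 0 := fun h0 => by
    have := act_injective hUt (h0.trans (map_zero (act U.transpose)).symm)
    rw [PiLp.single_eq_zero_iff] at this
    exact one_ne_zero this
  filter_upwards [ae_inner_ne_zero hne] with x hx heq
  apply hx
  rw [inner_act_left, Matrix.transpose_transpose, EuclideanSpace.inner_single_left, map_one,
    one_mul]
  rw [mul_assoc, mul_assoc, act_mul_apply, act_mul_apply, act_mul_apply, act_mul_apply] at heq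
  exact apply_eq_zero_of_act_signDiag_eq hi (act_injective hV heq)

end orthogonal

/-! ### Lebesgue partitions -/

namespace IsLebesguePartition

variable {n : ℕ} {E : (Fin n → ℤˣ) → Set (EuclideanSpace ℝ (Fin n))}

theorem ae_existsUnique (hE : IsLebesguePartition E) :
    ∀ᵐ x, ∃ s, x ∈ E s ∧ ∀ t, x ∈ E t → t = s := by
  have h1 : ∀ᵐ x, x ∈ ⋃ s, E s := by
    rw [ae_iff]; exact hE.compl_iUnion_null
  have h2 : ∀ᵐ x, ∀ s t, s ≠ t → x ∉ E s ∩ E t := by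
    simp_rw [ae_all_iff]
    exact fun s t hst => measure_eq_zero_iff_ae_notMem.1 (hE.inter_null s t hst)
  filter_upwards [h1, h2] with x hx hx'
  obtain ⟨s, hs⟩ := Set.mem_iUnion.1 hx
  exact ⟨s, hs, fun t ht => by_contra fun hts => hx' t s hts ⟨ht, hs⟩⟩

theorem ae_sum_eq (hE : IsLebesguePartition E)
    (f : (Fin n → ℤˣ) → EuclideanSpace ℝ (Fin n) → EuclideanSpace ℝ (Fin n)) :
    ∀ᵐ x, ∀ s, x ∈ E s → ∑ t, (E t).indicator (fun _ => (1 : ℝ)) x • f t x = f s x := by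
  filter_upwards [hE.ae_existsUnique] with x ⟨r, hr, hr'⟩ s hs
  rw [Finset.sum_eq_single s]
  · simp [hs]
  · intro t _ hts
    rw [Set.indicator_of_notMem, zero_smul]
    exact fun ht => hts ((hr' t ht).trans (hr' s hs).symm)
  · simp

theorem sum_restrict (hE : IsLebesguePartition E) {μ : Measure (EuclideanSpace ℝ (Fin n))}
    (hμ : μ ≪ volume) : Measure.sum (fun s => μ.restrict (E s)) = μ := by
  rw [← Measure.restrict_iUnion_ae, Measure.restrict_eq_self_of_ae_mem]
  · apply hμ.ae_le
    exact mem_ae_iff.2 hE.compl_iUnion_null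
  · exact fun s t hst => hμ (hE.inter_null s t hst)
  · exact fun s => (hE.measurableSet s).nullMeasurableSet

theorem exists_volume_pos (hE : IsLebesguePartition E) : ∃ s, 0 < volume (E s) := by
  by_contra! h
  have h1 : volume (⋃ s, E s) = 0 := measure_iUnion_null fun s => le_antisymm (h s) zero_le
  have h2 : (volume : Measure (EuclideanSpace ℝ (Fin n))) Set.univ = 0 := by
    rw [← Set.union_compl_self (⋃ s, E s)]
    exact measure_union_null h1 hE.compl_iUnion_null
  exact NeZero.ne _ (Measure.measure_univ_eq_zero.1 h2)

end IsLebesguePartition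

theorem isLebesguePartition_image {n : ℕ} {E : (Fin n → ℤˣ) → Set (EuclideanSpace ℝ (Fin n))}
    (hE : IsLebesguePartition E) {T : EuclideanSpace ℝ (Fin n) ≃ᵐ EuclideanSpace ℝ (Fin n)}
    (hT : (normalLaw 1).map T = normalLaw 1) : IsLebesguePartition fun s => T '' E s := by
  have hnull : ∀ F : Set (EuclideanSpace ℝ (Fin n)), volume F = 0 → volume (T '' F) = 0 := by
    intro F hF
    apply absolutelyContinuous_normalLaw Matrix.PosDef.one
    rw [← hT, T.map_apply, T.injective.preimage_image]
    exact normalLaw_absolutelyContinuous Matrix.PosDef.one hF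
  refine ⟨fun s => (T.measurableSet_image).2 (hE.measurableSet s), ?_, fun s t hst => ?_⟩
  · rw [← Set.image_iUnion, ← Set.image_compl_eq T.bijective]
    exact hnull _ hE.compl_iUnion_null
  · rw [← Set.image_inter T.injective]
    exact hnull _ (hE.inter_null s t hst)

/-! ### Piecewise orthogonal structure -/

/-- An automorphism preserving the standard normal law and the normality of sufficiently many
rank one perturbations of it is piecewise orthogonal. -/
theorem exists_partition_of_map_normalLaw {n : ℕ}
    {T : EuclideanSpace ℝ (Fin n) ≃ᵐ EuclideanSpace ℝ (Fin n)}
    (hT : (normalLaw 1).map T = normalLaw 1) {S Ψ : Fin n → Matrix (Fin n) (Fin n) ℝ}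
    {v : Fin n → EuclideanSpace ℝ (Fin n)} {c : Fin n → ℝ} (hv : ∀ j, ‖v j‖ = 1)
    (hc : ∀ j, c j ≠ 0) (hvB : ∀ z, (∀ j, inner ℝ (v j) z = 0) → z = 0)
    (hSv : ∀ j, S j = 1 + c j • Matrix.vecMulVec (v j) (v j)) (hS : ∀ j, (S j).PosDef)
    (hΨ : ∀ j, (Ψ j).PosDef) (hTS : ∀ j, (normalLaw (S j)).map T = normalLaw (Ψ j)) :
    ∃ U ∈ Matrix.orthogonalGroup (Fin n) ℝ, ∃ V ∈ Matrix.orthogonalGroup (Fin n) ℝ,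
    ∃ E : (Fin n → ℤˣ) → Set (EuclideanSpace ℝ (Fin n)),
      IsLebesguePartition E ∧
      IsLebesguePartition (fun s => act (V * signDiag s * U) '' E s) ∧
      (∀ᵐ x, T x = ∑ s, (E s).indicator (fun _ => (1 : ℝ)) x • act (V * signDiag s * U) x) ∧
      ∀ j s, 0 < volume (E s) →
        (V * signDiag s * U) * S j * (V * signDiag s * U)⁻¹ = Ψ j := by
  have hw : ∀ j, ∃ w : EuclideanSpace ℝ (Fin n),
      ∀ᵐ x, inner ℝ w (T x) ^ 2 = inner ℝ (v j) x ^ 2 := fun j =>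
    exists_inner_sq_comp_ae_eq (hv j) (hc j) (hSv j ▸ hS j) (hΨ j) hT (hSv j ▸ hTS j)
  choose w hw using hw
  set rows : (Fin n → EuclideanSpace ℝ (Fin n)) → Matrix (Fin n) (Fin n) ℝ :=
    fun v => Matrix.of fun j => WithLp.ofLp (v j) with hrows
  have hact : ∀ (v : Fin n → EuclideanSpace ℝ (Fin n)) x j,
      act (rows v) x j = inner ℝ (v j) x := fun v x j => by
    simp [Matrix.ofLp_toEuclideanCLM, rows, Matrix.mulVec, PiLp.inner_apply, dotProduct, mul_comm]
  set B := rows v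
  set W := rows w
  have hB : IsUnit B.det := by
    by_contra hB
    rw [isUnit_iff_ne_zero, not_not, ← Matrix.exists_mulVec_eq_zero_iff] at hB
    obtain ⟨z, hz, hBz⟩ := hB
    apply hz
    have : WithLp.toLp 2 z = (0 : EuclideanSpace ℝ (Fin n)) := hvB _ fun j => by
      rw [← hact]
      exact congrFun hBz j
    exact congrArg WithLp.ofLp this
  have hWB : ∀ᵐ x, ∀ j, act W (T x) j ^ 2 = act B x j ^ 2 := by
    rw [ae_all_iff]
    intro j
    filter_upwards [hw j] with x hx
    rw [hact, hact, hx]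
  have hW := isUnit_det_of_sq_comp_ae_eq hB hWB
  obtain ⟨U, hU, V, hV, hUV⟩ := exists_orthogonal_mul_signDiag_mul hW hB
  have hUd := isUnit_det_of_mem_orthogonalGroup hU
  have hVd := isUnit_det_of_mem_orthogonalGroup hV
  have hmeas : ∀ A : Matrix (Fin n) (Fin n) ℝ, MeasurableSet {x | T x = act A x} := fun A =>
    measurableSet_eq_fun T.measurable (act A).continuous.measurable
  set E : (Fin n → ℤˣ) → Set (EuclideanSpace ℝ (Fin n)) :=
    fun s => {x | T x = act (V * signDiag s * U) x} with hEdef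
  have hE : IsLebesguePartition E := by
    refine ⟨fun s => hmeas _, ?_, fun s t hst => ?_⟩
    -- Signs whose piece is null are discarded: for them `W⁻¹ s B` need not be orthogonal, hence
    -- need not equal `V s U`.
    · have hnull : ∀ᵐ x, ∀ s, volume {x | T x = act (W⁻¹ * signDiag s * B) x} = 0 →
          T x ≠ act (W⁻¹ * signDiag s * B) x := by
        rw [ae_all_iff]
        intro s
        by_cases h0 : volume {x | T x = act (W⁻¹ * signDiag s * B) x} = 0
        · filter_upwards [measure_eq_zero_iff_ae_notMem.1 h0] with x hx _ using hx
        · exact Filter.Eventually.of_forall fun x h => absurd h h0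
      have hcov : ∀ᵐ x, x ∈ ⋃ s, E s := by
        filter_upwards [hWB, hnull] with x hx hx'
        obtain ⟨s, hs⟩ := exists_act_eq_act_signDiag_mul hx
        have hTx : T x = act (W⁻¹ * signDiag s * B) x := by
          rw [mul_assoc, act_mul_apply, ← hs, ← act_mul_apply, Matrix.nonsing_inv_mul _ hW,
            act_one_apply]
        have h0 : volume {x | T x = act (W⁻¹ * signDiag s * B) x} ≠ 0 := fun h0 => hx' s h0 hTx
        have hdet : IsUnit (W⁻¹ * signDiag s * B).det := by
          rw [Matrix.det_mul, Matrix.det_mul]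
          exact ((Matrix.isUnit_nonsing_inv_det _ hW).mul (isUnit_det_signDiag s)).mul hB
        have horth := covariance_eq_of_eqOn Matrix.PosDef.one Matrix.PosDef.one hdet hT (hmeas _)
          h0 (fun x hx => hx)
        rw [mul_one] at horth
        refine Set.mem_iUnion.2 ⟨s, ?_⟩
        change T x = act (V * signDiag s * U) x
        rw [hUV s horth, hTx]
      exact hcov
    · rw [measure_eq_zero_iff_ae_notMem]
      filter_upwards [ae_act_mul_signDiag_mul_ne hUd hVd hst] with x hx hxE
      exact hx (hxE.1.symm.trans hxE.2)
  refine ⟨U, hU, V, hV, E, hE, ?_, ?_, fun j s hs => ?_⟩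
  -- On `E s` the linear map is `T` itself, so the images form a partition because `T` is bijective
  -- and preserves null sets.
  · have himg : (fun s => act (V * signDiag s * U) '' E s) = fun s => T '' E s :=
      funext fun s => (Set.EqOn.image_eq fun x hx => hx).symm
    rw [himg]
    exact isLebesguePartition_image hE hT
  · filter_upwards [hE.ae_sum_eq fun s => act (V * signDiag s * U), hE.ae_existsUnique]
      with x hx ⟨s, hs, _⟩
    rw [hx s hs]
    exact hs
  · have horth := mul_signDiag_mul_mem_orthogonalGroup hU hV s
    rw [inv_eq_transpose_of_mem_orthogonalGroup horth]
    exact covariance_eq_of_eqOn (hS j) (hΨ j) (isUnit_det_of_mem_orthogonalGroup horth) (hTS j)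
      (hmeas _) hs.ne' (fun x hx => hx)

/-! ### Gluing the pieces -/

/-- A piecewise linear map carrying a normal law piecewise to another one carries it to that one,
provided the pieces and their images form partitions. -/
theorem map_normalLaw_of_partition {n : ℕ} {T : EuclideanSpace ℝ (Fin n) → EuclideanSpace ℝ (Fin n)}
    (hT : Measurable T) {A : (Fin n → ℤˣ) → Matrix (Fin n) (Fin n) ℝ} (hA : ∀ s, IsUnit (A s).det)
    {E : (Fin n → ℤˣ) → Set (EuclideanSpace ℝ (Fin n))} (hE : IsLebesguePartition E)
    (hAE : IsLebesguePartition fun s => act (A s) '' E s)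
    (hTE : ∀ᵐ x, T x = ∑ s, (E s).indicator (fun _ => (1 : ℝ)) x • act (A s) x)
    {S Ψ : Matrix (Fin n) (Fin n) ℝ} (hS : S.PosDef) (hΨ : Ψ.PosDef)
    (h : ∀ s, 0 < volume (E s) → A s * S * (A s).transpose = Ψ) :
    (normalLaw S).map T = normalLaw Ψ := by
  have hpiece : ∀ s, ((normalLaw S).restrict (E s)).map T =
      (normalLaw Ψ).restrict (act (A s) '' E s) := by
    intro s
    by_cases h0 : volume (E s) = 0
    · have h1 : volume (act (A s) '' E s) = 0 := by
        rw [show act (A s) '' E s = (act (A s)).toLinearMap '' E s from rfl,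
          Measure.addHaar_image_linearMap, h0, mul_zero]
      rw [Measure.restrict_zero_set (normalLaw_absolutelyContinuous hS h0),
        Measure.restrict_zero_set (normalLaw_absolutelyContinuous hΨ h1), Measure.map_zero]
    · rw [← h s (pos_iff_ne_zero.2 h0), ← normalLaw_map hS.posSemidef]
      have he : (normalLaw S).map (act (A s)) = (normalLaw S).map (actEquiv (A s) (hA s)) := rfl
      have himg : act (A s) '' E s = actEquiv (A s) (hA s) '' E s := rfl
      rw [he, himg, (actEquiv (A s) (hA s)).restrict_map,
        (actEquiv (A s) (hA s)).injective.preimage_image]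
      refine Measure.map_congr ?_
      rw [Filter.EventuallyEq, ae_restrict_iff' (hE.measurableSet s)]
      filter_upwards [(normalLaw_absolutelyContinuous hS).ae_le hTE,
        (normalLaw_absolutelyContinuous hS).ae_le (hE.ae_sum_eq fun s => act (A s))]
        with x hx hx' hxs
      rw [hx, hx' s hxs]
      rfl
  rw [← hE.sum_restrict (normalLaw_absolutelyContinuous hS), Measure.map_sum hT.aemeasurable]
  simp_rw [hpiece]
  exact hAE.sum_restrict (normalLaw_absolutelyContinuous hΨ)

/-! ### Reduction to the standard law -/

/-- The range condition makes `u` an eigenvector, and symmetry turns the coefficient `⟨M x, u⟩` into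
`⟨x, M u⟩`. -/
theorem eq_smul_vecMulVec_of_range {n : ℕ} {M : Matrix (Fin n) (Fin n) ℝ} (hM : M.transpose = M)
    {u : EuclideanSpace ℝ (Fin n)} (hu : ‖u‖ = 1)
    (h : LinearMap.range (act M).toLinearMap = Submodule.span ℝ {u}) :
    ∃ c : ℝ, c ≠ 0 ∧ M = c • Matrix.vecMulVec u u := by
  have hmem : ∀ x, ∃ a : ℝ, act M x = a • u := fun x => by
    have : act M x ∈ Submodule.span ℝ {u} := h ▸ LinearMap.mem_range_self _ x
    obtain ⟨a, ha⟩ := Submodule.mem_span_singleton.1 this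
    exact ⟨a, ha.symm⟩
  obtain ⟨c, hc⟩ := hmem u
  have hMx : ∀ x, act M x = (c * inner ℝ u x) • u := fun x => by
    obtain ⟨a, ha⟩ := hmem x
    have h1 : inner ℝ (act M x) u = a := by
      rw [ha, inner_smul_left, real_inner_self_eq_norm_sq, hu]; simp
    rw [ha, ← h1, inner_act_left, hM, hc, inner_smul_right, real_inner_comm]
  refine ⟨c, ?_, ?_⟩
  · rintro rfl
    have hu' : u ∈ LinearMap.range (act M).toLinearMap := h ▸ Submodule.mem_span_singleton_self u
    obtain ⟨x, hx⟩ := hu'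
    have : u = 0 := by
      rw [← hx]
      exact (hMx x).trans (by simp)
    simp [this] at hu
  · apply (Matrix.toEuclideanCLM (n := Fin n) (𝕜 := ℝ)).injective
    ext x i
    change act M x i = act _ x i
    rw [hMx]
    simp [Matrix.ofLp_toEuclideanCLM, Matrix.vecMulVec_mulVec, PiLp.inner_apply, dotProduct,
      mul_comm, mul_left_comm]

theorem mul_vecMulVec_mul_transpose {n : ℕ} (A : Matrix (Fin n) (Fin n) ℝ)
    (u : EuclideanSpace ℝ (Fin n)) :
    A * Matrix.vecMulVec u u * A.transpose = Matrix.vecMulVec (act A u) (act A u) := by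
  rw [Matrix.mul_vecMulVec, Matrix.vecMulVec_mul, Matrix.vecMul_transpose,
    Matrix.ofLp_toEuclideanCLM]

theorem vecMulVec_normalize {n : ℕ} {u : EuclideanSpace ℝ (Fin n)} (hu : u ≠ 0) :
    Matrix.vecMulVec u u =
      ‖u‖ ^ 2 • Matrix.vecMulVec (‖u‖⁻¹ • u : EuclideanSpace ℝ (Fin n))
        (‖u‖⁻¹ • u : EuclideanSpace ℝ (Fin n)) := by
  have : ‖u‖ ≠ 0 := norm_ne_zero_iff.2 hu
  ext i j
  simp [Matrix.vecMulVec_apply]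
  field_simp

theorem map_normalLaw_conj {n : ℕ} {S S' Φ Φ' R P : Matrix (Fin n) (Fin n) ℝ}
    (hS : S.PosSemidef) (hΦ : Φ.PosSemidef) (hR : R * S * R.transpose = S')
    (hP : P * Φ * P.transpose = Φ') {T T' : EuclideanSpace ℝ (Fin n) → EuclideanSpace ℝ (Fin n)}
    (hT : Measurable T) (hT' : ∀ x, T' x = act P (T (act R x)))
    (h : (normalLaw S').map T = normalLaw Φ) : (normalLaw S).map T' = normalLaw Φ' := by
  have e : T' = act P ∘ T ∘ act R := funext hT'
  rw [e, ← Measure.map_map (by fun_prop) (by fun_prop), ← Measure.map_map hT (by fun_prop),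
    normalLaw_map hS, hR, h, normalLaw_map hΦ, hP]

theorem ae_act {n : ℕ} {A : Matrix (Fin n) (Fin n) ℝ} (hA : IsUnit A.det)
    {p : EuclideanSpace ℝ (Fin n) → Prop} (h : ∀ᵐ x, p x) : ∀ᵐ x, p (act A x) := by
  obtain ⟨c, -, hc⟩ := volume_map_act A hA
  refine ae_of_ae_map (act A).continuous.measurable.aemeasurable ?_
  rw [hc]
  exact Measure.smul_absolutelyContinuous.ae_le h

end NormalityPreserving

/-! ### The equivalence -/

open NormalityPreserving in
theorem corollary4p5 (n : ℕ)
    (T : EuclideanSpace ℝ (Fin n) ≃ᵐ EuclideanSpace ℝ (Fin n))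
    (S : Fin (n + 1) → Matrix (Fin n) (Fin n) ℝ)
    (hS : ∀ j, (S j).PosDef)
    (u : Module.Basis (Fin n) ℝ (EuclideanSpace ℝ (Fin n)))
    (hu : ∀ j, ‖u j‖ = 1)
    (hrank : ∀ j : Fin n, (S j.succ - S 0).rank = 1)
    (hrange : ∀ j : Fin n,
      LinearMap.range (act (S j.succ - S 0)).toLinearMap = Submodule.span ℝ {u j})
    (Ψ₀ : Matrix (Fin n) (Fin n) ℝ) (hΨ₀ : Ψ₀.PosDef) :
    (∃ Ψ : Fin (n + 1) → Matrix (Fin n) (Fin n) ℝ,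
        Ψ 0 = Ψ₀ ∧
        ∀ j, (Ψ j).PosDef ∧ (normalLaw (S j)).map T = normalLaw (Ψ j)) ↔
      ∃ U ∈ Matrix.orthogonalGroup (Fin n) ℝ, ∃ V ∈ Matrix.orthogonalGroup (Fin n) ℝ,
      ∃ E : (Fin n → ℤˣ) → Set (EuclideanSpace ℝ (Fin n)),
        IsLebesguePartition E ∧
        IsLebesguePartition (fun s => act (V * signDiag s * U) '' E s) ∧
        (∀ᵐ x : EuclideanSpace ℝ (Fin n),
          T x = ∑ s : Fin n → ℤˣ,
            (E s).indicator (fun _ => (1 : ℝ)) (act (sqrtMat (S 0))⁻¹ x) •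
              act (sqrtMat Ψ₀ * V * signDiag s * U * (sqrtMat (S 0))⁻¹) x) ∧
        ∀ j : Fin n, ∀ s t : Fin n → ℤˣ, 0 < volume (E s) → 0 < volume (E t) →
          (V * signDiag s * U) * ((sqrtMat (S 0))⁻¹ * S j.succ * (sqrtMat (S 0))⁻¹) *
              (V * signDiag s * U)⁻¹ =
            (V * signDiag t * U) * ((sqrtMat (S 0))⁻¹ * S j.succ * (sqrtMat (S 0))⁻¹) *
              (V * signDiag t * U)⁻¹ := by
  set R := sqrtMat (S 0)
  set P := sqrtMat Ψ₀
  have hRR : R * R = S 0 := sqrtMat_mul_self (hS 0)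
  have hPP : P * P = Ψ₀ := sqrtMat_mul_self hΨ₀
  have hRt : R.transpose = R := transpose_sqrtMat
  have hPt : P.transpose = P := transpose_sqrtMat
  have hR : IsUnit R.det := isUnit_det_sqrtMat (hS 0)
  have hP : IsUnit P.det := isUnit_det_sqrtMat hΨ₀
  have hRi : IsUnit R⁻¹.det := Matrix.isUnit_nonsing_inv_det _ hR
  have hPi : IsUnit P⁻¹.det := Matrix.isUnit_nonsing_inv_det _ hP
  have hRit : R⁻¹.transpose = R⁻¹ := by rw [Matrix.transpose_nonsing_inv, hRt]
  have hPit : P⁻¹.transpose = P⁻¹ := by rw [Matrix.transpose_nonsing_inv, hPt]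
  have hpdR : ∀ j, (R⁻¹ * S j * R⁻¹).PosDef := fun j => by
    have := posDef_mul_mul_transpose (hS j) hRi
    rwa [hRit] at this
  have hcancel : ∀ M N : Matrix (Fin n) (Fin n) ℝ, IsUnit M.det →
      M * (M⁻¹ * N * M⁻¹) * M = N := fun M N hM => by
    rw [mul_assoc M⁻¹, Matrix.mul_nonsing_inv_cancel_left _ _ hM, mul_assoc,
      Matrix.nonsing_inv_mul _ hM, mul_one]
  have hone : ∀ M N : Matrix (Fin n) (Fin n) ℝ, IsUnit M.det → M * M = N →
      M⁻¹ * N * M⁻¹ = 1 := fun M N hM h => by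
    rw [← h, Matrix.nonsing_inv_mul_cancel_left _ _ hM, Matrix.mul_nonsing_inv _ hM]
  let T' : EuclideanSpace ℝ (Fin n) ≃ᵐ EuclideanSpace ℝ (Fin n) :=
    ((actEquiv R hR).trans T).trans (actEquiv P⁻¹ hPi)
  have hT' : ∀ x, T' x = act P⁻¹ (T (act R x)) := fun x => rfl
  have hinvP : ∀ x, act P (act P⁻¹ x) = x := fun x => by
    rw [← act_mul_apply, Matrix.mul_nonsing_inv _ hP, act_one_apply]
  have hinvP' : ∀ x, act P⁻¹ (act P x) = x := fun x => by
    rw [← act_mul_apply, Matrix.nonsing_inv_mul _ hP, act_one_apply]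
  have hinvR : ∀ x, act R (act R⁻¹ x) = x := fun x => by
    rw [← act_mul_apply, Matrix.mul_nonsing_inv _ hR, act_one_apply]
  have hinvR' : ∀ x, act R⁻¹ (act R x) = x := fun x => by
    rw [← act_mul_apply, Matrix.nonsing_inv_mul _ hR, act_one_apply]
  have hTT' : ∀ x, T x = act P (T' (act R⁻¹ x)) := fun x => by rw [hT', hinvR, hinvP]
  have hform : ∀ (U V : Matrix (Fin n) (Fin n) ℝ) (s : Fin n → ℤˣ) (x),
      act (P * V * signDiag s * U * R⁻¹) x = act P (act (V * signDiag s * U) (act R⁻¹ x)) :=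
    fun U V s x => by simp only [← act_mul_apply, mul_assoc]
  constructor
  · rintro ⟨Ψ, hΨz, hΨ⟩
    have hpdP : ∀ j, (P⁻¹ * Ψ j * P⁻¹).PosDef := fun j => by
      have := posDef_mul_mul_transpose (hΨ j).1 hPi
      rwa [hPit] at this
    have hlaw : ∀ j, (normalLaw (R⁻¹ * S j * R⁻¹)).map T' = normalLaw (P⁻¹ * Ψ j * P⁻¹) :=
      fun j => map_normalLaw_conj (hpdR j).posSemidef (hΨ j).1.posSemidef
        (by rw [hRt, hcancel _ _ hR]) (by rw [hPit]) T.measurable hT' (hΨ j).2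
    have hlaw0 := hlaw 0
    rw [hone _ _ hR hRR, hone _ _ hP (hPP.trans hΨz.symm)] at hlaw0
    have hsymm : ∀ j : Fin n, (S j.succ - S 0).transpose = S j.succ - S 0 := fun j => by
      have h1 := (hS j.succ).isHermitian.eq
      have h2 := (hS 0).isHermitian.eq
      rw [Matrix.conjTranspose_eq_transpose_of_trivial] at h1 h2
      rw [Matrix.transpose_sub, h1, h2]
    choose c hc hSc using fun j => eq_smul_vecMulVec_of_range (hsymm j) (hu j) (hrange j)
    have hRu : ∀ j, act R⁻¹ (u j) ≠ 0 := fun j h0 =>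
      u.ne_zero j (act_injective hRi (h0.trans (map_zero (act R⁻¹)).symm))
    have hRn : ∀ j, ‖act R⁻¹ (u j)‖ ≠ 0 := fun j => norm_ne_zero_iff.2 (hRu j)
    obtain ⟨U, hU, V, hV, E, hE, hVE, hTE, hcov⟩ := exists_partition_of_map_normalLaw hlaw0
      (S := fun j => R⁻¹ * S j.succ * R⁻¹) (Ψ := fun j => P⁻¹ * Ψ j.succ * P⁻¹)
      -- Whitening by `R⁻¹` destroys the unit length of `u j`; after renormalizing, the coefficient
      -- absorbs the squared norm.
      (v := fun j => ‖act R⁻¹ (u j)‖⁻¹ • act R⁻¹ (u j))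
      (c := fun j => c j * ‖act R⁻¹ (u j)‖ ^ 2)
      (fun j => by rw [norm_smul, norm_inv, norm_norm, inv_mul_cancel₀ (hRn j)])
      (fun j => mul_ne_zero (hc j) (pow_ne_zero 2 (hRn j)))
      (fun z hz => by
        have h0 : act R⁻¹ z = 0 := InnerProductSpace.ext_inner_left_basis u fun j => by
          have := hz j
          rw [inner_smul_left, inner_act_left, hRit] at this
          rw [inner_zero_right]
          exact (mul_eq_zero.1 this).resolve_left (by simpa using hRu j)
        exact act_injective hRi (h0.trans (map_zero (act R⁻¹)).symm))
      (fun j => by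
        have h1 : S j.succ = S 0 + c j • Matrix.vecMulVec (u j) (u j) := by
          rw [← hSc j]; abel
        have h2 := mul_vecMulVec_mul_transpose R⁻¹ (u j)
        rw [hRit] at h2
        rw [h1, mul_add, add_mul, hone _ _ hR hRR, mul_smul_comm, smul_mul_assoc, h2,
          vecMulVec_normalize (hRu j), smul_smul])
      (fun j => hpdR j.succ) (fun j => hpdP j.succ) (fun j => hlaw j.succ)
    refine ⟨U, hU, V, hV, E, hE, hVE, ?_, fun j s t hs ht => (hcov j s hs).trans (hcov j t ht).symm⟩
    filter_upwards [ae_act hRi hTE] with x hx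
    rw [hTT', hx, map_sum]
    simp only [hform, map_smul]
  · rintro ⟨U, hU, V, hV, E, hE, hVE, hTE, hcov⟩
    have horth := mul_signDiag_mul_mem_orthogonalGroup hU hV
    have hTE' : ∀ᵐ x, T' x =
        ∑ s, (E s).indicator (fun _ => (1 : ℝ)) x • act (V * signDiag s * U) x := by
      filter_upwards [ae_act hR hTE] with x hx
      rw [hT', hx, map_sum]
      simp only [hform, map_smul, hinvR', hinvP']
    -- Any nonnull piece can define the target covariances, since (c) makes all nonnull pieces
    -- agree.
    obtain ⟨r, hr⟩ := hE.exists_volume_pos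
    set L := V * signDiag r * U with hL
    have hLd : IsUnit L.det := isUnit_det_of_mem_orthogonalGroup (horth r)
    have key : ∀ j, (∀ s, 0 < volume (E s) →
        (V * signDiag s * U) * (R⁻¹ * S j * R⁻¹) * (V * signDiag s * U).transpose =
          L * (R⁻¹ * S j * R⁻¹) * L.transpose) →
        (normalLaw (S j)).map T =
          normalLaw (P * (L * (R⁻¹ * S j * R⁻¹) * L.transpose) * P.transpose) := fun j hj =>
      map_normalLaw_conj (hS j).posSemidef
        (posDef_mul_mul_transpose (hpdR j) hLd).posSemidef (by rw [hRit]) rfl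
        T'.measurable hTT'
        (map_normalLaw_of_partition T'.measurable
          (fun s => isUnit_det_of_mem_orthogonalGroup (horth s)) hE hVE hTE' (hpdR j)
          (posDef_mul_mul_transpose (hpdR j) hLd) hj)
    have hzero : ∀ s, (V * signDiag s * U) * (R⁻¹ * S 0 * R⁻¹) *
        (V * signDiag s * U).transpose = 1 := fun s => by
      rw [hone _ _ hR hRR, mul_one]
      exact (Matrix.mem_orthogonalGroup_iff _ _).1 (horth s)
    refine ⟨fun j => P * (L * (R⁻¹ * S j * R⁻¹) * L.transpose) * P.transpose, ?_, fun j =>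
      ⟨posDef_mul_mul_transpose (posDef_mul_mul_transpose (hpdR j) hLd) hP, key j ?_⟩⟩
    · simp only [hL, hzero, mul_one, hPt, hPP]
    -- Condition (c) says nothing about index `0`; there the whitened covariance is the identity,
    -- which every orthogonal conjugation fixes.
    · refine Fin.cases (fun s _ => ?_) (fun j s hs => ?_) j
      · rw [hzero, hzero]
      · have := hcov j s r hs hr
        rwa [inv_eq_transpose_of_mem_orthogonalGroup (horth s),
          inv_eq_transpose_of_mem_orthogonalGroup (horth r)] at this
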